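/- **Setting.** Let $\mathcal X\subseteq\mathbb R^n$ be a measurable safe set with $0<\mathrm{vol}(\mathcal X)<\infty$, let $P$ be the uniform probability distribution on $\mathcal X$, let $\mathbb U\subseteq\mathbb R^s$ be compact and let $f:\mathbb R^n\times\mathbb U\to\mathbb R^n$ be continuous (dynamics $x(t+1)=f(x(t),u(t))$). Let $h(a,x)$, $a\in\mathbb R^m$, $x\in\mathbb R^n$, be affine in $a$ for each $x$, measurable in $x$, and $h(a,x)<0$ for all $a$ and all $x\notin\mathcal X$. Fix controls $u_1,\dots,u_M\in\mathbb U$, measurable weight functions $w_1^L,\dots,w_M^L$ on $\mathbb R^n$ that on $\mathcal X$ satisfy $w_j^L\ge 0$ and $\sum_j w_j^L=1$ (for instance, weights learned beforehand from a separate data set), states $x_0,x_1',\dots,x_{N'}'\in\mathcal X$, and constants $\gamma\in(0,1)$, $\epsilon_0>0$, $\overline\lambda>0$, $U_{a_l}\ge\epsilon_0$ $(l=1,\dots,m)$; none of these depends on the samples. For a sample $\mathbb X=(x_1,\dots,x_N)$ consider the linear program $$\min_{a\in\mathbb R^m,\ \lambda\in\mathbb R}\ \lambda\quad\text{s.t.}\quad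 \begin{cases} h(a,x_0)\ge\epsilon_0,\\ \sum_{j=1}^M w_j^L(x_i)\,h(a,f(x_i,u_j))\ \ge\ \gamma h(a,x_i)-\lambda,\quad i=1,\dots,N,\\ \lambda\in[0,\overline\lambda],\quad a_l\in[-U_{a_l},U_{a_l}],\quad l=1,\dots,m,\end{cases}\tag{1}$$ with solution $(a^*(\mathbb X),\lambda^*(\mathbb X))$. If $\lambda^*(\mathbb X)=0$, then $a^*(\mathbb X)$ is taken to be the solution of $$\max_{a\in\mathbb R^m}\ \sum_{i=1}^{N'}h(a,x_i')\quad\text{s.t.}\quad \begin{cases} h(a,x_0)\ge\epsilon_0,\\ \sum_{j=1}^M w_j^L(x_i)\,h(a,f(x_i,u_j))\ \ge\ \gamma h(a,x_i),\quad i=1,\dots,N,\\ a_l\in[-U_{a_l},U_{a_l}],\quad l=1,\dots,m.\end{cases}\tag{2}$$ If (2) has several optimal solutions, one is selected by a tie-break rule: a finite (possibly empty) list of fixed continuous convex functions $t_1,\dots,t_p$ of $a$ is given; among the optimal solutions of (2) those minimizing $t_1$ are kept, among these those minimizing $t_2$, and so on. It is assumed that for every sample in $\mathcal X^N$ at most one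 point survives (as is always the case, for example, for the coordinates $t_l(a)=a_l$, $l=1,\dots,m$). **Theorem.** Let $\alpha,\beta\in(0,1)$ and let $N\ge1$ satisfy $\alpha\ge\frac2N\left(\ln\frac1\beta+m+1\right)$. Put $\widetilde{\mathbb S}=\{x\in\mathcal X: h(a^*(\mathbb X),x)\ge0\}$. If $x_1,\dots,x_N$ are drawn independently from $P$, then with confidence at least $1-\beta$ (that is, on a measurable set of samples of $P^N$-measure at least $1-\beta$) the following holds: if $\lambda^*(\mathbb X)=0$ and $P[x\in\widetilde{\mathbb S}]\ne0$, then $$P\big[\exists u\in\mathbb U:\ f(x,u)\in\widetilde{\mathbb S}\ \big|\ x\in\widetilde{\mathbb S}\big]\ \ge\ 1-\frac{\alpha}{P[x\in\widetilde{\mathbb S}]}.$$ Moreover, if $h(a,\cdot)$ is continuous on $\mathcal X$ for every $a$ and every neighbourhood of $x_0$ has positive $P$-measure (for instance, if $x_0$ is an interior point of $\mathcal X$), then $P[x\in\widetilde{\mathbb S}]\ne0$ for every sample $\mathbb X$ for which (1) has a solution. -/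

import Mathlib

open MeasureTheory Topology

noncomputable section

/-- Minimizers of `t` over the set `K`. -/
def argminOn {V : Type*} (t : V → ℝ) (K : Set V) : Set V :=
  {a | a ∈ K ∧ ∀ b ∈ K, t a ≤ t b}

/-- Successive tie-breaking: among the points of `K` keep those that minimize the first function,
among these those that minimize the second one, and so on. -/
def tieBreak {V : Type*} : List (V → ℝ) → Set V → Set V
  | [], K => K
  | t :: ts, K => tieBreak ts (argminOn t K)

/-- The data of the synthesis problem: state dimension `n`, control dimension `s`, `m` template
parameters, `M` sampled controls, and `N'` fixed points in the volume surrogate. -/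
structure CSISData (n s m M N' : ℕ) where
  /-- the safe set -/
  X : Set (EuclideanSpace ℝ (Fin n))
  /-- the set of admissible controls -/
  U : Set (EuclideanSpace ℝ (Fin s))
  /-- the dynamics `x(t+1) = f (x(t)) (u(t))` -/
  f : EuclideanSpace ℝ (Fin n) → EuclideanSpace ℝ (Fin s) → EuclideanSpace ℝ (Fin n)
  /-- the barrier template `h(a, x)` -/
  h : (Fin m → ℝ) → EuclideanSpace ℝ (Fin n) → ℝ
  /-- the sampled controls -/
  u : Fin M → EuclideanSpace ℝ (Fin s)
  /-- the fixed weight functions -/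
  w : Fin M → EuclideanSpace ℝ (Fin n) → ℝ
  /-- the state at which the template has to be at least `ε₀` -/
  x₀ : EuclideanSpace ℝ (Fin n)
  ε₀ : ℝ
  γ : ℝ
  /-- upper bound for the slack variable -/
  lamBar : ℝ
  /-- bounds for the absolute values of the parameters -/
  bound : Fin m → ℝ
  /-- the fixed states in the volume surrogate -/
  x' : Fin N' → EuclideanSpace ℝ (Fin n)
  /-- further tie-break functions, used only if the volume surrogate leaves several optima -/
  ties : List ((Fin m → ℝ) → ℝ)

namespace CSISData

variable {n s m M N' : ℕ} (D : CSISData n s m M N')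

/-- The uniform distribution on the safe set. -/
def P : Measure (EuclideanSpace ℝ (Fin n)) := ProbabilityTheory.cond volume D.X

/-- The set of `(a, lam)` satisfying the constraints of the linear program built from the
samples `ω`. -/
def feasible {N : ℕ} (ω : Fin N → EuclideanSpace ℝ (Fin n)) : Set ((Fin m → ℝ) × ℝ) :=
  {z | D.ε₀ ≤ D.h z.1 D.x₀ ∧
    (∀ i, D.γ * D.h z.1 (ω i) - z.2 ≤ ∑ j, D.w j (ω i) * D.h z.1 (D.f (ω i) (D.u j))) ∧
    z.2 ∈ Set.Icc 0 D.lamBar ∧ ∀ l, z.1 l ∈ Set.Icc (-D.bound l) (D.bound l)}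

/-- The optimal solutions of the linear program: minimize `lam` over the feasible set. -/
def lpOptimal {N : ℕ} (ω : Fin N → EuclideanSpace ℝ (Fin n)) : Set ((Fin m → ℝ) × ℝ) :=
  argminOn Prod.snd (D.feasible ω)

/-- The feasible set of the second program, where the slack variable is absent. -/
def feasibleZero {N : ℕ} (ω : Fin N → EuclideanSpace ℝ (Fin n)) : Set (Fin m → ℝ) :=
  {a | D.ε₀ ≤ D.h a D.x₀ ∧
    (∀ i, D.γ * D.h a (ω i) ≤ ∑ j, D.w j (ω i) * D.h a (D.f (ω i) (D.u j))) ∧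
    ∀ l, a l ∈ Set.Icc (-D.bound l) (D.bound l)}

/-- The optimal solutions of the second program: maximize the volume surrogate. -/
def surrogateOptimal {N : ℕ} (ω : Fin N → EuclideanSpace ℝ (Fin n)) : Set (Fin m → ℝ) :=
  {a | a ∈ D.feasibleZero ω ∧ ∀ b ∈ D.feasibleZero ω, ∑ i, D.h b (D.x' i) ≤ ∑ i, D.h a (D.x' i)}

/-- The optima of the second program that survive all the tie-break functions. -/
def selected {N : ℕ} (ω : Fin N → EuclideanSpace ℝ (Fin n)) : Set (Fin m → ℝ) :=
  tieBreak D.ties (D.surrogateOptimal ω)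

/-- `(a, lam)` is the solution `(a*(ω), λ*(ω))` returned for the samples `ω`: it is optimal for the
linear program, and if `lam = 0` then `a` is obtained from the second program. -/
structure IsSolution {N : ℕ} (ω : Fin N → EuclideanSpace ℝ (Fin n)) (a : Fin m → ℝ) (lam : ℝ) :
    Prop where
  optimal : (a, lam) ∈ D.lpOptimal ω
  tie_break : lam = 0 → a ∈ D.selected ω

/-- The set `{x ∈ X | h(a, x) ≥ 0}`. -/
def S (a : Fin m → ℝ) : Set (EuclideanSpace ℝ (Fin n)) := {x | x ∈ D.X ∧ 0 ≤ D.h a x}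

/-- `T` is a probabilistic one-step controlled safety invariant set with respect to `α`. -/
def IsProbabilisticCSIS (α : ℝ) (T : Set (EuclideanSpace ℝ (Fin n))) : Prop :=
  T ⊆ D.X ∧ D.P T ≠ 0 ∧
    1 - α / D.P.real T ≤ (ProbabilityTheory.cond D.P T).real {x | ∃ v ∈ D.U, D.f x v ∈ T}

end CSISData

end

/-- `b` is smaller than `a` in the lexicographic order given by the values of the functions in
the list. -/
def LexLess {V : Type*} : List (V → ℝ) → V → V → Prop
  | [], _, _ => False
  | t :: ts, b, a => t b < t a ∨ (t b = t a ∧ LexLess ts b a)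

theorem mem_tieBreak_iff {V : Type*} (ts : List (V → ℝ)) (K : Set V) (a : V) :
    a ∈ tieBreak ts K ↔ a ∈ K ∧ ∀ b ∈ K, ¬ LexLess ts b a := by
  induction ts generalizing K with
  | nil => simp [tieBreak, LexLess]
  | cons t ts ih =>
    simp only [tieBreak, ih, argminOn, Set.mem_ofPred_eq, LexLess, not_or, not_and, not_lt]
    constructor
    · rintro ⟨⟨haK, hmin⟩, hlex⟩
      exact ⟨haK, fun b hb => ⟨hmin b hb, fun hba => hlex b ⟨hb, fun c hc => hba ▸ hmin c hc⟩⟩⟩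
    · rintro ⟨haK, hlex⟩
      refine ⟨⟨haK, fun b hb => (hlex b hb).1⟩, fun b hb => (hlex b hb.1).2 ?_⟩
      exact le_antisymm (hb.2 a haK) (hlex b hb.1).1

theorem convex_setOf_lexLess {V : Type*} [AddCommGroup V] [Module ℝ V] (ts : List (V → ℝ))
    (hts : ∀ t ∈ ts, ConvexOn ℝ Set.univ t) (a : V) : Convex ℝ {b | LexLess ts b a} := by
  induction ts with
  | nil => simpa [LexLess] using convex_empty
  | cons t ts ih =>
    have ih := ih fun t' ht' => hts t' (List.mem_cons_of_mem _ ht')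
    have ht := hts t List.mem_cons_self
    rw [convex_iff_forall_pos] at ih ⊢
    intro x hx y hy p q hp hq hpq
    have hle := ht.2 (Set.mem_univ x) (Set.mem_univ y) hp.le hq.le hpq
    simp only [smul_eq_mul] at hle
    have hsplit : t a = p * t a + q * t a := by rw [← add_mul, hpq, one_mul]
    rcases hx with hx | ⟨hx, hx'⟩
    · have hy' : t y ≤ t a := hy.elim le_of_lt fun h => h.1.le
      left
      nlinarith [mul_lt_mul_of_pos_left hx hp, mul_le_mul_of_nonneg_left hy' hq.le]
    · rcases hy with hy | ⟨hy, hy'⟩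
      · left
        rw [hx] at hle
        nlinarith [mul_lt_mul_of_pos_left hy hq]
      · rw [hx, hy, ← hsplit] at hle
        rcases hle.lt_or_eq with h | h
        · exact Or.inl h
        · exact Or.inr ⟨h, ih hx' hy' hp hq hpq⟩

/-- A lexicographic optimum of a convex program in dimension `d` is already the optimum of every
subprogram that retains certain `d` of the constraints. -/
theorem exists_support_constraints {V ι : Type*} [AddCommGroup V] [Module ℝ V]
    [FiniteDimensional ℝ V] [Fintype ι] (ts : List (V → ℝ))
    (hts : ∀ t ∈ ts, ConvexOn ℝ Set.univ t) {B : Set V} (hB : Convex ℝ B) {C : ι → Set V}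
    (hC : ∀ i, Convex ℝ (C i)) {a : V} (ha : a ∈ tieBreak ts {b | b ∈ B ∧ ∀ i, b ∈ C i}) :
    ∃ I : Finset ι, I.card ≤ Module.finrank ℝ V ∧
      ∀ T : Finset ι, I ⊆ T → a ∈ tieBreak ts {b | b ∈ B ∧ ∀ i ∈ T, b ∈ C i} := by
  classical
  simp only [mem_tieBreak_iff, Set.mem_ofPred_eq] at ha ⊢
  obtain ⟨⟨haB, haC⟩, hlex⟩ := ha
  let F : Option ι → Set V := fun o => o.elim {b | b ∈ B ∧ LexLess ts b a} C
  have hF : ∀ o ∈ (Finset.univ : Finset (Option ι)), Convex ℝ (F o) := by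
    rintro (_ | i) -
    · exact hB.inter (convex_setOf_lexLess ts hts a)
    · exact hC i
  have hempty : ¬ (⋂ o ∈ (Finset.univ : Finset (Option ι)), F o).Nonempty := by
    rintro ⟨b, hb⟩
    simp only [Finset.mem_univ, Set.iInter_true, Set.mem_iInter] at hb
    exact hlex b ⟨(hb none).1, fun i => hb (some i)⟩ (hb none).2
  have := mt (Convex.helly_theorem' hF) hempty
  push Not at this
  obtain ⟨J, -, hJ, hJe⟩ := this
  have hnone : none ∈ J := by
    by_contra hn
    have : a ∈ ⋂ o ∈ J, F o := by
      simp only [Set.mem_iInter]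
      rintro (_ | i) ho
      · exact absurd ho hn
      · exact haC i
    simp [hJe] at this
  refine ⟨J.eraseNone, ?_, fun T hT => ⟨⟨haB, fun i _ => haC i⟩, fun b hb hba => ?_⟩⟩
  · have := Finset.card_eraseNone_of_mem hnone
    omega
  · have : b ∈ ⋂ o ∈ J, F o := by
      simp only [Set.mem_iInter]
      rintro (_ | i) ho
      · exact ⟨hb.1, hba⟩
      · exact hb.2 i (hT (Finset.mem_eraseNone.2 ho))
    simp [hJe] at this

theorem measurableSet_exists_mem_nonpos {Ω V : Type*} [MeasurableSpace Ω] [TopologicalSpace V]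
    [SecondCountableTopology V] {B : Set V} (hB : IsCompact B) {φ : Ω → V → ℝ}
    (hm : ∀ a, Measurable fun ω => φ ω a) (hc : ∀ ω, Continuous (φ ω)) :
    MeasurableSet {ω | ∃ a ∈ B, φ ω a ≤ 0} := by
  obtain ⟨Q, hQ, hQd⟩ := TopologicalSpace.exists_countable_dense B
  have key : {ω | ∃ a ∈ B, φ ω a ≤ 0} =
      ⋂ k : ℕ, ⋃ q ∈ Q, {ω | φ ω (q : V) < 1 / ((k : ℝ) + 1)} := by
    ext ω
    simp only [Set.mem_ofPred_eq, Set.mem_iInter, Set.mem_iUnion, exists_prop]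
    constructor
    · rintro ⟨a, haB, ha⟩ k
      have hopen : IsOpen {b : B | φ ω b < 1 / ((k : ℝ) + 1)} :=
        isOpen_lt ((hc ω).comp continuous_subtype_val) continuous_const
      obtain ⟨q, hq, hqQ⟩ := hQd.inter_open_nonempty _ hopen
        ⟨⟨a, haB⟩, lt_of_le_of_lt ha (by positivity)⟩
      exact ⟨q, hqQ, hq⟩
    · intro h
      obtain ⟨q₀, -, -⟩ := h 0
      obtain ⟨a, haB, hmin⟩ := hB.exists_isMinOn ⟨q₀, q₀.2⟩ (hc ω).continuousOn
      refine ⟨a, haB, le_of_not_gt fun hpos => ?_⟩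
      obtain ⟨k, hk⟩ := exists_nat_one_div_lt hpos
      obtain ⟨q, -, hq⟩ := h k
      exact absurd (hmin q.2) (not_le.2 (hq.trans hk))
  rw [key]
  exact MeasurableSet.iInter fun k => MeasurableSet.biUnion hQ fun q _ =>
    measurableSet_lt (hm q) measurable_const

/-- The tie-broken solution set of a parametric program is again described by a single
Carathéodory inequality. -/
theorem exists_caratheodory_tieBreak {Ω V : Type*} [MeasurableSpace Ω] [TopologicalSpace V]
    [SecondCountableTopology V] {B : Set V} (hB : IsCompact B) (ts : List (V → ℝ))
    (hts : ∀ t ∈ ts, Continuous t) (φ : Ω → V → ℝ)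
    (hm : ∀ a, Measurable fun ω => φ ω a) (hc : ∀ ω, Continuous (φ ω)) :
    ∃ ψ : Ω → V → ℝ, (∀ a, Measurable fun ω => ψ ω a) ∧ (∀ ω, Continuous (ψ ω)) ∧
      ∀ ω, tieBreak ts {a | a ∈ B ∧ φ ω a ≤ 0} = {a | a ∈ B ∧ ψ ω a ≤ 0} := by
  induction ts generalizing φ with
  | nil => exact ⟨φ, hm, hc, fun _ => rfl⟩
  | cons t ts ih =>
    have ht : Continuous t := hts t List.mem_cons_self
    let K : Ω → Set V := fun ω => {a | a ∈ B ∧ φ ω a ≤ 0}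
    have hKc : ∀ ω, IsCompact (K ω) := fun ω =>
      hB.inter_right (isClosed_le (hc ω) continuous_const)
    let v : Ω → ℝ := fun ω => sInf (t '' K ω)
    have hmin : ∀ ω, (K ω).Nonempty → ∃ a ∈ K ω, t a = v ω ∧ ∀ b ∈ K ω, t a ≤ t b := by
      intro ω hne
      obtain ⟨a, haK, ha, hab⟩ := (hKc ω).exists_sInf_image_eq_and_le hne ht.continuousOn
      exact ⟨a, haK, ha.symm, hab⟩
    have hK : MeasurableSet {ω | (K ω).Nonempty} := measurableSet_exists_mem_nonpos hB hm hc
    have hv : Measurable v := by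
      refine measurable_of_Iic fun r => ?_
      have hr : MeasurableSet {ω | ∃ a ∈ B, max (φ ω a) (t a - r) ≤ 0} :=
        measurableSet_exists_mem_nonpos hB (fun a => (hm a).max measurable_const)
          fun ω => (hc ω).max (ht.sub continuous_const)
      have : v ⁻¹' Set.Iic r = {ω | ∃ a ∈ B, max (φ ω a) (t a - r) ≤ 0} ∪
          ({ω | (K ω).Nonempty}ᶜ ∩ {_ω | 0 ≤ r}) := by
        ext ω
        simp only [Set.mem_preimage, Set.mem_Iic, Set.mem_union, Set.mem_ofPred_eq, Set.mem_inter_iff,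
          Set.mem_compl_iff, max_le_iff, sub_nonpos]
        by_cases hne : (K ω).Nonempty
        · obtain ⟨a, haK, ha, hab⟩ := hmin ω hne
          simp only [hne, not_true_eq_false, false_and, or_false]
          exact ⟨fun h => ⟨a, haK.1, haK.2, ha.le.trans h⟩,
            fun ⟨b, hbB, hb, hbr⟩ => ha ▸ (hab b ⟨hbB, hb⟩).trans hbr⟩
        · have hv0 : v ω = 0 := by
            simp [v, Set.not_nonempty_iff_eq_empty.1 hne]
          simp only [hne, hv0, not_false_eq_true, true_and]
          exact ⟨Or.inr, fun h => h.elim (fun ⟨b, hbB, hb, _⟩ => absurd ⟨b, hbB, hb⟩ hne) id⟩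
      rw [this]
      exact hr.union (hK.compl.inter (MeasurableSet.const _))
    obtain ⟨ψ, hψm, hψc, hψ⟩ := ih (fun t' ht' => hts t' (List.mem_cons_of_mem _ ht'))
      (fun ω a => max (φ ω a) (t a - v ω)) (fun a => (hm a).max (measurable_const.sub hv))
      fun ω => (hc ω).max (ht.sub continuous_const)
    refine ⟨ψ, hψm, hψc, fun ω => ?_⟩
    rw [← hψ ω, tieBreak]
    congr 1
    ext a
    simp only [argminOn, Set.mem_ofPred_eq, max_le_iff, sub_nonpos]
    constructor
    · rintro ⟨haK, ha⟩
      obtain ⟨b, hbK, hb, -⟩ := hmin ω ⟨a, haK⟩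
      exact ⟨haK.1, haK.2, hb ▸ ha b hbK⟩
    · rintro ⟨haB, ha, hav⟩
      obtain ⟨b, -, hb, hbc⟩ := hmin ω ⟨a, haB, ha⟩
      exact ⟨⟨haB, ha⟩, fun c hc => hav.trans (hb ▸ hbc c hc)⟩

theorem measurableSet_graph_tieBreak {Ω V : Type*} [MeasurableSpace Ω] [TopologicalSpace V]
    [TopologicalSpace.MetrizableSpace V] [SecondCountableTopology V] [MeasurableSpace V] [BorelSpace V]
    {B : Set V} (hB : IsCompact B) (ts : List (V → ℝ)) (hts : ∀ t ∈ ts, Continuous t)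
    {φ : Ω → V → ℝ} (hm : ∀ a, Measurable fun ω => φ ω a) (hc : ∀ ω, Continuous (φ ω)) :
    MeasurableSet {p : Ω × V | p.2 ∈ tieBreak ts {a | a ∈ B ∧ φ p.1 a ≤ 0}} := by
  obtain ⟨ψ, hψm, hψc, hψ⟩ := exists_caratheodory_tieBreak hB ts hts φ hm hc
  simp only [hψ, Set.mem_ofPred_eq]
  have hψ' : Measurable fun p : Ω × V => ψ p.1 p.2 :=
    (measurable_uncurry_of_continuous_of_measurable (u := fun a ω => ψ ω a) hψc hψm).comp
      measurable_swap
  exact (measurable_snd hB.measurableSet).inter (measurableSet_le hψ' measurable_const)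

section Scenario

variable {Ω V : Type*} [MeasurableSpace Ω] [TopologicalSpace V] [MeasurableSpace V]

/-- The event that the optimum for the scenarios `p.1` violates the constraint with probability
more than `α` although it satisfies all the constraints given by `p.2`. -/
def undetectedViolation {ι κ : Type*} (P : Measure Ω) (X : Set Ω) (B : Set V) (g : V → Ω → ℝ)
    (ts : List (V → ℝ)) (α : ℝ) : Set ((ι → Ω) × (κ → Ω)) :=
  {p | (∀ i, p.1 i ∈ X) ∧ ∃ a ∈ tieBreak ts {a | a ∈ B ∧ ∀ i, 0 ≤ g a (p.1 i)},
    α < P.real {x | g a x < 0} ∧ ∀ j, 0 ≤ g a (p.2 j)}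

variable [PolishSpace V] [BorelSpace V] [StandardBorelSpace Ω]

theorem measurableSet_undetectedViolation {ι κ : Type*} [Fintype ι] [Fintype κ] (P : Measure Ω)
    [IsProbabilityMeasure P] {X : Set Ω} (hX : MeasurableSet X) {B : Set V} (hB : IsCompact B)
    {g : V → Ω → ℝ} (hgc : ∀ x, Continuous fun a => g a x) (hgm : ∀ a, Measurable (g a))
    {ts : List (V → ℝ)} (hts : ∀ t ∈ ts, Continuous t) (α : ℝ)
    (huniq : ∀ y : ι → Ω, (∀ i, y i ∈ X) →
      (tieBreak ts {a | a ∈ B ∧ ∀ i, 0 ≤ g a (y i)}).Subsingleton) :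
    MeasurableSet (undetectedViolation (ι := ι) (κ := κ) P X B g ts α) := by
  have hg : Measurable fun q : V × Ω => g q.1 q.2 :=
    measurable_uncurry_of_continuous_of_measurable hgc hgm
  have hsum : ∀ (y : ι → Ω) (a : V), (∀ i, 0 ≤ g a (y i)) ↔ ∑ i, max 0 (-g a (y i)) ≤ 0 := by
    intro y a
    have hnn : ∀ i ∈ Finset.univ, 0 ≤ max 0 (-g a (y i)) := fun i _ => le_max_left _ _
    rw [(Finset.sum_nonneg hnn).ge_iff_eq', Finset.sum_eq_zero_iff_of_nonneg hnn]
    simp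
  have hgraph : MeasurableSet {q : (ι → Ω) × V |
      q.2 ∈ tieBreak ts {a | a ∈ B ∧ ∀ i, 0 ≤ g a (q.1 i)}} := by
    simp only [hsum]
    exact measurableSet_graph_tieBreak hB ts hts
      (φ := fun (y : ι → Ω) a => ∑ i, max 0 (-g a (y i)))
      (fun a => Finset.measurable_sum _ fun i _ =>
        measurable_const.max ((hgm a).comp (measurable_pi_apply i)).neg)
      fun y => continuous_finsetSum _ fun i _ => continuous_const.max (hgc _).neg
  have hviol : Measurable fun a => P.real {x | g a x < 0} :=
    (measurable_measure_prodMk_left (measurableSet_lt hg measurable_const)).ennreal_toReal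
  let G : Set (((ι → Ω) × (κ → Ω)) × V) :=
    {q | (∀ i, q.1.1 i ∈ X) ∧ q.2 ∈ tieBreak ts {a | a ∈ B ∧ ∀ i, 0 ≤ g a (q.1.1 i)} ∧
      α < P.real {x | g q.2 x < 0} ∧ ∀ j, 0 ≤ g q.2 (q.1.2 j)}
  have hGX : MeasurableSet {q : ((ι → Ω) × (κ → Ω)) × V | ∀ i, q.1.1 i ∈ X} :=
    (MeasurableSet.iInter fun i => (show Measurable fun q : ((ι → Ω) × (κ → Ω)) × V => q.1.1 i by
      fun_prop) hX).congr (by ext; simp)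
  have hGg : MeasurableSet {q : ((ι → Ω) × (κ → Ω)) × V | ∀ j, 0 ≤ g q.2 (q.1.2 j)} :=
    (MeasurableSet.iInter fun j => measurableSet_le (measurable_const (a := (0 : ℝ)))
      (hg.comp (measurable_snd.prodMk ((measurable_pi_apply j).comp measurable_fst.snd)))).congr
      (by ext; simp)
  have hG : MeasurableSet G :=
    hGX.inter (((measurable_fst.fst.prodMk measurable_snd) hgraph).inter
      ((measurableSet_lt measurable_const (hviol.comp measurable_snd)).inter hGg))
  have himage : undetectedViolation (ι := ι) (κ := κ) P X B g ts α = Prod.fst '' G := by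
    ext p
    constructor
    · rintro ⟨hp, a, ha, hv, hs⟩
      exact ⟨(p, a), ⟨hp, ha, hv, hs⟩, rfl⟩
    · rintro ⟨⟨p, a⟩, ⟨hp, ha, hv, hs⟩, rfl⟩
      exact ⟨hp, a, ha, hv, hs⟩
  rw [himage]
  refine hG.image_of_measurable_injOn measurable_fst ?_
  rintro ⟨p, a⟩ ⟨hp, ha, -⟩ ⟨p', a'⟩ ⟨-, ha', -⟩ rfl
  exact Prod.ext rfl (huniq p.1 hp ha ha')

theorem prod_undetectedViolation_le {ι κ : Type*} [Fintype ι] [Fintype κ] (P : Measure Ω)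
    [IsProbabilityMeasure P] {X : Set Ω} (hX : MeasurableSet X) {B : Set V} (hB : IsCompact B)
    {g : V → Ω → ℝ} (hgc : ∀ x, Continuous fun a => g a x) (hgm : ∀ a, Measurable (g a))
    {ts : List (V → ℝ)} (hts : ∀ t ∈ ts, Continuous t) {α : ℝ}
    (huniq : ∀ y : ι → Ω, (∀ i, y i ∈ X) →
      (tieBreak ts {a | a ∈ B ∧ ∀ i, 0 ≤ g a (y i)}).Subsingleton) :
    ((Measure.pi fun _ : ι => P).prod (Measure.pi fun _ : κ => P))
      (undetectedViolation P X B g ts α) ≤ ENNReal.ofReal (1 - α) ^ Fintype.card κ := by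
  rw [Measure.prod_apply (measurableSet_undetectedViolation P hX hB hgc hgm hts α huniq)]
  calc _ ≤ ∫⁻ _ : ι → Ω, ENNReal.ofReal (1 - α) ^ Fintype.card κ ∂(Measure.pi fun _ => P) := by
        refine lintegral_mono fun y => ?_
        rcases Set.eq_empty_or_nonempty
          (Prod.mk y ⁻¹' undetectedViolation (κ := κ) P X B g ts α) with h | ⟨z, hy, a, ha, hv, -⟩
        · simp [h]
        have hsub : Prod.mk y ⁻¹' undetectedViolation (κ := κ) P X B g ts α ⊆
            Set.univ.pi fun _ => {x | 0 ≤ g a x} := by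
          rintro z' ⟨-, a', ha', -, hz'⟩ j -
          rw [huniq y hy ha ha']
          exact hz' j
        refine (measure_mono hsub).trans ?_
        rw [Measure.pi_pi, Finset.prod_const, Finset.card_univ]
        gcongr
        have hm : MeasurableSet {x | g a x < 0} := measurableSet_lt (hgm a) measurable_const
        have hcompl : {x | 0 ≤ g a x} = {x | g a x < 0}ᶜ := by ext; simp
        rw [← ENNReal.ofReal_toReal (measure_ne_top P _)]
        refine ENNReal.ofReal_le_ofReal ?_
        change P.real _ ≤ _
        rw [hcompl, probReal_compl_eq_one_sub hm]
        linarith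
    _ = _ := by simp

/-- Scenario bound: the optimum of a convex program with `N` random constraints violates a fresh
constraint with probability more than `α` with probability at most `2 ^ d * exp (-α * N / 2)`,
where `d` exceeds the dimension by one. -/
theorem scenario_violation_le [AddCommGroup V] [Module ℝ V] [FiniteDimensional ℝ V]
    (P : Measure Ω) [IsProbabilityMeasure P] {X : Set Ω} (hX : MeasurableSet X)
    {B : Set V} (hB : IsCompact B) (hBc : Convex ℝ B)
    {g : V → Ω → ℝ} (hgc : ∀ x, Continuous fun a => g a x) (hgm : ∀ a, Measurable (g a))
    (hgx : ∀ x, Convex ℝ {a | 0 ≤ g a x})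
    {ts : List (V → ℝ)} (hts : ∀ t ∈ ts, ConvexOn ℝ Set.univ t ∧ Continuous t)
    {α : ℝ} (hα : α ≤ 1) {N : ℕ} (hN : 0 < N)
    (huniq : ∀ y : Fin N → Ω, (∀ i, y i ∈ X) →
      (tieBreak ts {a | a ∈ B ∧ ∀ i, 0 ≤ g a (y i)}).Subsingleton) :
    (Measure.pi fun _ : Fin N => P) {ω | (∀ i, ω i ∈ X) ∧
        ∃ a ∈ tieBreak ts {a | a ∈ B ∧ ∀ i, 0 ≤ g a (ω i)}, α < P.real {x | g a x < 0}} ≤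
      ENNReal.ofReal (2 ^ (Module.finrank ℝ V + 1) * Real.exp (-(α * N / 2))) := by
  classical
  set μ := Measure.pi fun _ : Fin N => P
  set Bad := {ω : Fin N → Ω | (∀ i, ω i ∈ X) ∧
    ∃ a ∈ tieBreak ts {a | a ∈ B ∧ ∀ i, 0 ≤ g a (ω i)}, α < P.real {x | g a x < 0}}
  set d := Module.finrank ℝ V + 1 with hd
  have htc : ∀ t ∈ ts, Continuous t := fun t ht => (hts t ht).2
  let e : ∀ T : Finset (Fin N), (Fin N → Ω) ≃ᵐ ({i // i ∈ T} → Ω) × ({i // i ∉ T} → Ω) :=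
    fun T => MeasurableEquiv.piEquivPiSubtypeProd (fun _ => Ω) (fun i => i ∈ T)
  let A : Finset (Fin N) → Set (Fin N → Ω) := fun T =>
    e T ⁻¹' undetectedViolation P X B g ts α
  have hsub : ∀ T : Finset (Fin N), T.Nonempty → ∀ y : {i // i ∈ T} → Ω, (∀ i, y i ∈ X) →
      (tieBreak ts {a | a ∈ B ∧ ∀ i, 0 ≤ g a (y i)}).Subsingleton := by
    rintro T ⟨i₀, hi₀⟩ y hy
    let ω : Fin N → Ω := fun i => if h : i ∈ T then y ⟨i, h⟩ else y ⟨i₀, hi₀⟩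
    have hω : ∀ i (h : i ∈ T), ω i = y ⟨i, h⟩ := fun i h => dif_pos h
    convert huniq ω fun i => ?_ using 5 with a
    · constructor
      · intro h i
        by_cases hi : i ∈ T
        · rw [hω i hi]; exact h _
        · simp only [ω, hi, dif_neg, not_false_eq_true]; exact h _
      · rintro h ⟨i, hi⟩
        rw [← hω i hi]; exact h i
    · by_cases hi : i ∈ T
      · rw [hω i hi]; exact hy _
      · simp only [ω, hi, dif_neg, not_false_eq_true]; exact hy _
  have hAm : ∀ T : Finset (Fin N), T.Nonempty → MeasurableSet (A T) := fun T hT =>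
    (e T).measurable (measurableSet_undetectedViolation P hX hB hgc hgm htc α (hsub T hT))
  have hAle : ∀ T : Finset (Fin N), T.Nonempty →
      μ (A T) ≤ ENNReal.ofReal (1 - α) ^ (N - T.card) := by
    intro T hT
    let : Fintype {i // i ∈ T} := Subtype.fintype _
    have hpres := measurePreserving_piEquivPiSubtypeProd (fun _ : Fin N => P) (fun i => i ∈ T)
    have := hpres.measure_preimage
      (measurableSet_undetectedViolation P hX hB hgc hgm htc α (hsub T hT)).nullMeasurableSet
    refine this.le.trans ((prod_undetectedViolation_le P hX hB hgc hgm htc (hsub T hT)).trans ?_)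
    rw [Fintype.card_subtype_compl]
    simp
  let S : Finset (Finset (Fin N)) := Finset.univ.filter Finset.Nonempty
  let F : (Fin N → Ω) → ENNReal := fun ω => ∑ T ∈ S, (A T).indicator 1 ω
  have hFm : Measurable F := Finset.measurable_sum _ fun T hT =>
    measurable_one.indicator (hAm T (Finset.mem_filter.1 hT).2)
  have hFint : ∫⁻ ω, F ω ∂μ ≤ ENNReal.ofReal ((2 - α) ^ N) := by
    calc ∫⁻ ω, F ω ∂μ = ∑ T ∈ S, μ (A T) := by
          rw [lintegral_finsetSum' _ fun T hT =>
            (measurable_one.indicator (hAm T (Finset.mem_filter.1 hT).2)).aemeasurable]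
          exact Finset.sum_congr rfl fun T hT =>
            lintegral_indicator_one (hAm T (Finset.mem_filter.1 hT).2)
      _ ≤ ∑ T ∈ S, ENNReal.ofReal (1 - α) ^ (N - T.card) :=
          Finset.sum_le_sum fun T hT => hAle T (Finset.mem_filter.1 hT).2
      _ ≤ ∑ T : Finset (Fin N), 1 ^ T.card * ENNReal.ofReal (1 - α) ^ (N - T.card) := by
          simp only [one_pow, one_mul]
          exact Finset.sum_le_sum_of_subset (Finset.subset_univ _)
      _ = ENNReal.ofReal ((2 - α) ^ N) := by
          rw [Fin.sum_pow_mul_eq_add_pow, ENNReal.ofReal_pow (by linarith), ← ENNReal.ofReal_one,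
            ← ENNReal.ofReal_add zero_le_one (by linarith)]
          congr 2
          ring
  have hlow : Bad ⊆ {ω | 2 ^ N ≤ 2 ^ d * F ω} := by
    rintro ω ⟨hωX, a, ha, hv⟩
    obtain ⟨I₀, hI₀, hI₀T⟩ := exists_support_constraints ts (fun t ht => (hts t ht).1) hBc
      (fun i => hgx (ω i)) ha
    let I := insert ⟨0, hN⟩ I₀
    have hIc : I.card ≤ d := (Finset.card_insert_le _ _).trans (by omega)
    have hIN : I.card ≤ N := by simpa using I.card_le_univ
    have hmem : ∀ T ∈ Finset.Icc I Finset.univ, T ∈ S ∧ ω ∈ A T := by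
      intro T hT
      have hIT : I ⊆ T := (Finset.mem_Icc.1 hT).1
      refine ⟨Finset.mem_filter.2 ⟨Finset.mem_univ _, _, hIT (Finset.mem_insert_self _ _)⟩,
        fun i => hωX i, a, ?_, hv, fun j => ?_⟩
      · convert hI₀T T ((Finset.subset_insert _ _).trans hIT) using 5
        exact Subtype.forall
      · have := (mem_tieBreak_iff _ _ _).1 ha
        exact this.1.2 j
    have hcard : (2 : ENNReal) ^ (N - I.card) ≤ F ω := by
      calc (2 : ENNReal) ^ (N - I.card) = ∑ T ∈ Finset.Icc I Finset.univ, 1 := by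
            rw [Finset.sum_const, Finset.card_Icc_finset (Finset.subset_univ _)]
            simp
        _ = ∑ T ∈ Finset.Icc I Finset.univ, (A T).indicator 1 ω :=
            Finset.sum_congr rfl fun T hT => by simp [(hmem T hT).2]
        _ ≤ F ω := Finset.sum_le_sum_of_subset fun T hT => (hmem T hT).1
    calc (2 : ENNReal) ^ N = 2 ^ I.card * 2 ^ (N - I.card) := by
          rw [← pow_add]; congr 1; omega
      _ ≤ 2 ^ d * F ω := by
          gcongr
          norm_num
  have hmarkov : 2 ^ N * μ Bad ≤ 2 ^ d * ENNReal.ofReal ((2 - α) ^ N) := by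
    calc 2 ^ N * μ Bad ≤ 2 ^ N * μ {ω | 2 ^ N ≤ 2 ^ d * F ω} := by gcongr
      _ ≤ ∫⁻ ω, 2 ^ d * F ω ∂μ := mul_meas_ge_le_lintegral (hFm.const_mul _) _
      _ = 2 ^ d * ∫⁻ ω, F ω ∂μ := lintegral_const_mul _ hFm
      _ ≤ _ := by gcongr
  have hreal : 2 ^ N * μ.real Bad ≤ 2 ^ d * (2 - α) ^ N := by
    have h := ENNReal.toReal_mono (by finiteness) hmarkov
    rwa [ENNReal.toReal_mul, ENNReal.toReal_mul, ENNReal.toReal_pow, ENNReal.toReal_pow,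
      ENNReal.toReal_ofReal (pow_nonneg (by linarith) _)] at h
  rw [← ENNReal.ofReal_toReal (measure_ne_top μ Bad)]
  refine ENNReal.ofReal_le_ofReal ?_
  have hexp : (1 - α / 2) ^ N ≤ Real.exp (-(α * N / 2)) := by
    calc (1 - α / 2) ^ N ≤ Real.exp (-(α / 2)) ^ N :=
          pow_le_pow_left₀ (by linarith) (by linarith [Real.add_one_le_exp (-(α / 2))]) _
      _ = _ := by rw [← Real.exp_nat_mul]; congr 1; ring
  have hpow : (2 - α) ^ N = 2 ^ N * (1 - α / 2) ^ N := by rw [← mul_pow]; congr 1; ring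
  have h2 : (0 : ℝ) < 2 ^ N := by positivity
  calc μ.real Bad ≤ 2 ^ d * (1 - α / 2) ^ N := by
        refine le_of_mul_le_mul_left ?_ h2
        rw [hpow] at hreal
        linarith
    _ ≤ _ := by gcongr

end Scenario

namespace CSISData

variable {n s m M N' : ℕ} (D : CSISData n s m M N')

/-- The margin by which the weighted one-step constraint holds at the state `x`. -/
def margin (a : Fin m → ℝ) (x : EuclideanSpace ℝ (Fin n)) : ℝ :=
  ∑ j, D.w j x * D.h a (D.f x (D.u j)) - D.γ * D.h a x

/-- The sample-independent part of the feasible set. -/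
def parameterSet : Set (Fin m → ℝ) :=
  {a | D.ε₀ ≤ D.h a D.x₀ ∧ ∀ l, a l ∈ Set.Icc (-D.bound l) (D.bound l)}

/-- The negated volume surrogate. -/
def negSurrogate (a : Fin m → ℝ) : ℝ := -∑ i, D.h a (D.x' i)

theorem selected_eq_tieBreak {N : ℕ} (ω : Fin N → EuclideanSpace ℝ (Fin n)) :
    D.selected ω = tieBreak (D.negSurrogate :: D.ties)
      {a | a ∈ D.parameterSet ∧ ∀ i, 0 ≤ D.margin a (ω i)} := by
  have hfeas : D.feasibleZero ω = {a | a ∈ D.parameterSet ∧ ∀ i, 0 ≤ D.margin a (ω i)} := by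
    ext a
    simp only [feasibleZero, parameterSet, margin, Set.mem_ofPred_eq, sub_nonneg]
    tauto
  rw [selected, tieBreak, surrogateOptimal, argminOn, hfeas]
  simp only [negSurrogate, neg_le_neg_iff]

variable {D}

theorem continuous_h
    (hh_affine : ∀ x, ∃ (L : (Fin m → ℝ) →ₗ[ℝ] ℝ) (c : ℝ), ∀ a, D.h a x = L a + c)
    (x : EuclideanSpace ℝ (Fin n)) : Continuous fun a => D.h a x := by
  obtain ⟨L, c, hL⟩ := hh_affine x
  simp only [hL]
  exact L.continuous_of_finiteDimensional.add continuous_const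

theorem margin_affine
    (hh_affine : ∀ x, ∃ (L : (Fin m → ℝ) →ₗ[ℝ] ℝ) (c : ℝ), ∀ a, D.h a x = L a + c)
    (x : EuclideanSpace ℝ (Fin n)) :
    ∃ (L : (Fin m → ℝ) →ₗ[ℝ] ℝ) (c : ℝ), ∀ a, D.margin a x = L a + c := by
  choose L c hL using hh_affine
  refine ⟨∑ j, D.w j x • L (D.f x (D.u j)) - D.γ • L x,
    ∑ j, D.w j x * c (D.f x (D.u j)) - D.γ * c x, fun a => ?_⟩
  simp only [margin, hL, mul_add, Finset.sum_add_distrib, LinearMap.sub_apply,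
    LinearMap.sum_apply, LinearMap.smul_apply, smul_eq_mul]
  ring

theorem continuous_margin
    (hh_affine : ∀ x, ∃ (L : (Fin m → ℝ) →ₗ[ℝ] ℝ) (c : ℝ), ∀ a, D.h a x = L a + c)
    (x : EuclideanSpace ℝ (Fin n)) : Continuous fun a => D.margin a x := by
  obtain ⟨L, c, hL⟩ := margin_affine hh_affine x
  simp only [hL]
  exact L.continuous_of_finiteDimensional.add continuous_const

theorem convex_setOf_margin_nonneg
    (hh_affine : ∀ x, ∃ (L : (Fin m → ℝ) →ₗ[ℝ] ℝ) (c : ℝ), ∀ a, D.h a x = L a + c)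
    (x : EuclideanSpace ℝ (Fin n)) :
    Convex ℝ {a | 0 ≤ D.margin a x} := by
  obtain ⟨L, c, hL⟩ := margin_affine hh_affine x
  simp only [hL, ← neg_le_iff_add_nonneg]
  exact convex_halfSpace_ge L.isLinear _

theorem negSurrogate_convex_continuous
    (hh_affine : ∀ x, ∃ (L : (Fin m → ℝ) →ₗ[ℝ] ℝ) (c : ℝ), ∀ a, D.h a x = L a + c) :
    ConvexOn ℝ Set.univ D.negSurrogate ∧ Continuous D.negSurrogate := by
  refine ⟨?_, (continuous_finsetSum _ fun i _ => continuous_h hh_affine _).neg⟩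
  choose L c hL using hh_affine
  have : D.negSurrogate = fun a => (-∑ i, L (D.x' i)) a + (-∑ i, c (D.x' i)) := by
    ext a
    simp only [negSurrogate, hL, Finset.sum_add_distrib, LinearMap.neg_apply, LinearMap.sum_apply]
    ring
  rw [this]
  exact (LinearMap.convexOn _ convex_univ).add_const _

theorem isCompact_parameterSet
    (hh_affine : ∀ x, ∃ (L : (Fin m → ℝ) →ₗ[ℝ] ℝ) (c : ℝ), ∀ a, D.h a x = L a + c) :
    IsCompact D.parameterSet := by
  have hbox : IsCompact (Set.univ.pi fun l => Set.Icc (-D.bound l) (D.bound l)) :=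
    isCompact_univ_pi fun _ => isCompact_Icc
  convert hbox.inter_left (isClosed_le (continuous_const (y := D.ε₀))
    (continuous_h hh_affine D.x₀)) using 1
  refine Set.ext fun a => ?_
  simp only [parameterSet, Set.mem_ofPred_eq, Set.mem_inter_iff, Set.mem_univ_pi]

theorem convex_parameterSet
    (hh_affine : ∀ x, ∃ (L : (Fin m → ℝ) →ₗ[ℝ] ℝ) (c : ℝ), ∀ a, D.h a x = L a + c) :
    Convex ℝ D.parameterSet := by
  have hbox : Convex ℝ (Set.univ.pi fun l => Set.Icc (-D.bound l) (D.bound l)) :=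
    convex_pi fun _ _ => convex_Icc _ _
  obtain ⟨L, c, hL⟩ := hh_affine D.x₀
  have heq : D.parameterSet = {a | D.ε₀ - c ≤ L a} ∩
      Set.univ.pi fun l => Set.Icc (-D.bound l) (D.bound l) := by
    refine Set.ext fun a => ?_
    simp only [parameterSet, hL, Set.mem_ofPred_eq, Set.mem_inter_iff, Set.mem_univ_pi,
      sub_le_iff_le_add]
  rw [heq]
  exact (convex_halfSpace_ge L.isLinear (D.ε₀ - c)).inter hbox

theorem measurable_margin (hf : ContinuousOn (Function.uncurry D.f) (Set.univ ×ˢ D.U))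
    (hh_meas : ∀ a, Measurable (D.h a)) (hu : ∀ j, D.u j ∈ D.U)
    (hw_meas : ∀ j, Measurable (D.w j)) (a : Fin m → ℝ) : Measurable (D.margin a) := by
  have hfu : ∀ j, Continuous fun x => D.f x (D.u j) := fun j =>
    hf.comp_continuous (f := fun x => (x, D.u j)) (by fun_prop) fun x => ⟨trivial, hu j⟩
  exact (Finset.measurable_sum _ fun j _ =>
    (hw_meas j).mul ((hh_meas a).comp (hfu j).measurable)).sub ((hh_meas a).const_mul _)

/-- Where the margin is nonnegative, some sampled control keeps the state in `S a`. -/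
theorem exists_control_of_margin_nonneg (hh_neg : ∀ a, ∀ x, x ∉ D.X → D.h a x < 0)
    (hu : ∀ j, D.u j ∈ D.U) (hw_nonneg : ∀ j, ∀ x ∈ D.X, 0 ≤ D.w j x)
    (hw_sum : ∀ x ∈ D.X, ∑ j, D.w j x = 1) (hγ : 0 ≤ D.γ) {a : Fin m → ℝ}
    {x : EuclideanSpace ℝ (Fin n)} (hx : x ∈ D.S a) (hmargin : 0 ≤ D.margin a x) :
    ∃ v ∈ D.U, D.f x v ∈ D.S a := by
  have hnonneg : 0 ≤ ∑ j, D.w j x * D.h a (D.f x (D.u j)) :=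
    (mul_nonneg hγ hx.2).trans (sub_nonneg.1 hmargin)
  obtain ⟨j, hj⟩ : ∃ j, 0 ≤ D.h a (D.f x (D.u j)) := by
    by_contra! hneg
    have hterm : ∀ j ∈ Finset.univ, D.w j x * D.h a (D.f x (D.u j)) ≤ 0 := fun j _ =>
      mul_nonpos_of_nonneg_of_nonpos (hw_nonneg j x hx.1) (hneg j).le
    have hzero := (Finset.sum_eq_zero_iff_of_nonpos hterm).1
      (le_antisymm (Finset.sum_nonpos hterm) hnonneg)
    have hw : ∑ j, D.w j x = 0 := Finset.sum_eq_zero fun j hj =>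
      (mul_eq_zero.1 (hzero j hj)).resolve_right (hneg j).ne
    exact one_ne_zero ((hw_sum x hx.1).symm.trans hw)
  refine ⟨D.u j, hu j, by_contra fun hX => ?_, hj⟩
  exact absurd (hh_neg a _ hX) (not_lt.2 hj)

theorem isProbabilisticCSIS_S [IsProbabilityMeasure D.P] {α : ℝ} {a : Fin m → ℝ}
    (hS : MeasurableSet (D.S a))
    (hcontrol : ∀ x ∈ D.S a, 0 ≤ D.margin a x → ∃ v ∈ D.U, D.f x v ∈ D.S a)
    (hviol : D.P.real {x | D.margin a x < 0} ≤ α) (hne : D.P (D.S a) ≠ 0) :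
    D.IsProbabilisticCSIS α (D.S a) := by
  refine ⟨fun x hx => hx.1, hne, ?_⟩
  have hpos : 0 < D.P.real (D.S a) :=
    ENNReal.toReal_pos hne (measure_ne_top _ _)
  have hcover : D.S a ⊆ (D.S a ∩ {x | ∃ v ∈ D.U, D.f x v ∈ D.S a}) ∪ {x | D.margin a x < 0} := by
    intro x hx
    rcases lt_or_ge (D.margin a x) 0 with h | h
    · exact Or.inr h
    · exact Or.inl ⟨hx, hcontrol x hx h⟩
  have hle : D.P.real (D.S a) ≤
      D.P.real (D.S a ∩ {x | ∃ v ∈ D.U, D.f x v ∈ D.S a}) + α :=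
    (measureReal_mono hcover).trans ((measureReal_union_le _ _).trans (by gcongr))
  have hcond : (ProbabilityTheory.cond D.P (D.S a)).real {x | ∃ v ∈ D.U, D.f x v ∈ D.S a} =
      D.P.real (D.S a ∩ {x | ∃ v ∈ D.U, D.f x v ∈ D.S a}) / D.P.real (D.S a) := by
    simp only [Measure.real, ProbabilityTheory.cond_apply hS, ENNReal.toReal_mul,
      ENNReal.toReal_inv, div_eq_inv_mul]
  rw [hcond, one_sub_div hpos.ne']
  gcongr
  linarith

end CSISData

theorem theorem1 {n s m M N' : ℕ} (D : CSISData n s m M N')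
    -- the safe set carries a uniform distribution
    (hX : MeasurableSet D.X) (hX_pos : volume D.X ≠ 0) (hX_fin : volume D.X ≠ ⊤)
    -- compact control set, continuous dynamics
    (hU : IsCompact D.U)
    (hf : ContinuousOn (Function.uncurry D.f) (Set.univ ×ˢ D.U))
    -- the template is affine in the parameters, negative outside the safe set, and measurable
    (hh_affine : ∀ x, ∃ (L : (Fin m → ℝ) →ₗ[ℝ] ℝ) (c : ℝ), ∀ a, D.h a x = L a + c)
    (hh_neg : ∀ a, ∀ x, x ∉ D.X → D.h a x < 0)
    (hh_meas : ∀ a, Measurable (D.h a))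
    -- sampled controls and fixed weight functions
    (hu : ∀ j, D.u j ∈ D.U)
    (hw_meas : ∀ j, Measurable (D.w j))
    (hw_nonneg : ∀ j, ∀ x ∈ D.X, 0 ≤ D.w j x)
    (hw_sum : ∀ x ∈ D.X, ∑ j, D.w j x = 1)
    -- the remaining parameters
    (hx₀ : D.x₀ ∈ D.X) (hε₀ : 0 < D.ε₀) (hγ : D.γ ∈ Set.Ioo (0 : ℝ) 1)
    (hlam : 0 < D.lamBar) (hbound : ∀ l, D.ε₀ ≤ D.bound l)
    (hx' : ∀ i, D.x' i ∈ D.X)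
    (α β : ℝ) (hα : α ∈ Set.Ioo (0 : ℝ) 1) (hβ : β ∈ Set.Ioo (0 : ℝ) 1)
    (N : ℕ) (hN : 0 < N)
    -- convex tie-break functions that single out one optimum
    (hties : ∀ t ∈ D.ties, ConvexOn ℝ Set.univ t ∧ Continuous t)
    (hunique : ∀ ω : Fin N → EuclideanSpace ℝ (Fin n), (∀ i, ω i ∈ D.X) →
      (D.selected ω).Subsingleton)
    (hαN : 2 / (N : ℝ) * (Real.log (1 / β) + m + 1) ≤ α) :
    -- with confidence at least `1 - β`, if `λ* = 0` then the computed set is invariant up to `α`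
    (∃ E : Set (Fin N → EuclideanSpace ℝ (Fin n)), MeasurableSet E ∧
      1 - β ≤ (Measure.pi fun _ : Fin N => D.P).real E ∧
      ∀ ω ∈ E, ∀ a lam, D.IsSolution ω a lam → lam = 0 → D.P (D.S a) ≠ 0 →
        D.IsProbabilisticCSIS α (D.S a)) ∧
    -- the computed set is never null if `h` is continuous on the safe set and
    -- `x₀` is in the support of the uniform distribution
    ((∀ a, ContinuousOn (D.h a) D.X) → (∀ V ∈ 𝓝 D.x₀, D.P V ≠ 0) →
      ∀ ω : Fin N → EuclideanSpace ℝ (Fin n), ∀ a lam, D.IsSolution ω a lam →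
        D.P (D.S a) ≠ 0) := by
  have hP : IsProbabilityMeasure D.P :=
    ProbabilityTheory.cond_isProbabilityMeasure_of_finite hX_pos hX_fin
  have hPX : ∀ᵐ x ∂D.P, x ∈ D.X := ProbabilityTheory.ae_cond_mem hX
  refine ⟨?_, fun hcont hsupp ω a lam hsol => ?_⟩
  · have hmargin := CSISData.measurable_margin hf hh_meas hu hw_meas
    set μ := Measure.pi fun _ : Fin N => D.P
    have hscenario := scenario_violation_le D.P hX
      (CSISData.isCompact_parameterSet hh_affine) (CSISData.convex_parameterSet hh_affine)
      (CSISData.continuous_margin hh_affine) hmargin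
      (CSISData.convex_setOf_margin_nonneg hh_affine) (ts := D.negSurrogate :: D.ties)
      (by
        intro t ht
        rcases List.mem_cons.1 ht with rfl | ht
        · exact CSISData.negSurrogate_convex_continuous hh_affine
        · exact hties t ht)
      hα.2.le hN (fun ω hω => D.selected_eq_tieBreak ω ▸ hunique ω hω)
    simp only [← CSISData.selected_eq_tieBreak] at hscenario
    set Bad := {ω : Fin N → EuclideanSpace ℝ (Fin n) | (∀ i, ω i ∈ D.X) ∧
      ∃ a ∈ D.selected ω, α < D.P.real {x | D.margin a x < 0}}
    have hexp : 2 ^ (Module.finrank ℝ (Fin m → ℝ) + 1) * Real.exp (-(α * N / 2)) ≤ β := by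
      have hN' : (0 : ℝ) < N := Nat.cast_pos.2 hN
      have hlog : Real.log (1 / β) + (m + 1) ≤ α * N / 2 := by
        rw [div_mul_eq_mul_div, div_le_iff₀ hN'] at hαN
        linarith
      rw [one_div, Real.log_inv] at hlog
      have h2 : (2 : ℝ) ≤ Real.exp 1 := by linarith [Real.add_one_le_exp 1]
      calc (2 : ℝ) ^ (Module.finrank ℝ (Fin m → ℝ) + 1) * Real.exp (-(α * N / 2))
          ≤ Real.exp 1 ^ (m + 1) * Real.exp (Real.log β - (m + 1)) := by
            rw [Module.finrank_fin_fun]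
            gcongr
            linarith
        _ = β := by
            rw [← Real.exp_nat_mul, ← Real.exp_add]
            push_cast
            rw [mul_one, add_sub_cancel, Real.exp_log hβ.1]
    have hallX : ∀ᵐ ω ∂μ, ∀ i, ω i ∈ D.X :=
      ae_all_iff.2 fun i => (Measure.quasiMeasurePreserving_eval _ i).ae hPX
    have hXm : MeasurableSet {ω : Fin N → EuclideanSpace ℝ (Fin n) | ∀ i, ω i ∈ D.X} :=
      (MeasurableSet.iInter fun i => measurable_pi_apply i hX).congr (by ext; simp)
    refine ⟨{ω | ∀ i, ω i ∈ D.X} ∩ (toMeasurable μ Bad)ᶜ,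
      hXm.inter (measurableSet_toMeasurable _ _).compl, ?_, ?_⟩
    · have hEq : μ.real ({ω | ∀ i, ω i ∈ D.X} ∩ (toMeasurable μ Bad)ᶜ) =
          μ.real (toMeasurable μ Bad)ᶜ :=
        measureReal_congr (by
          filter_upwards [hallX] with ω hω
          exact propext ⟨fun h => h.2, fun h => ⟨hω, h⟩⟩)
      rw [hEq, probReal_compl_eq_one_sub (measurableSet_toMeasurable _ _), Measure.real,
        measure_toMeasurable]
      have : (μ Bad).toReal ≤ β := ENNReal.toReal_le_of_le_ofReal hβ.1.le
        (hscenario.trans (ENNReal.ofReal_le_ofReal hexp))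
      linarith
    · rintro ω ⟨hω, hgood⟩ a lam hsol hlam0 hne
      have hsel := hsol.tie_break hlam0
      have hviol : D.P.real {x | D.margin a x < 0} ≤ α := by
        by_contra! h
        exact hgood (subset_toMeasurable _ _ ⟨hω, a, hsel, h⟩)
      exact CSISData.isProbabilisticCSIS_S
        (hX.inter (measurableSet_le measurable_const (hh_meas a)))
        (fun x hx => CSISData.exists_control_of_margin_nonneg hh_neg hu hw_nonneg hw_sum
          hγ.1.le hx) hviol hne
  · have hpos : 0 < D.h a D.x₀ := hε₀.trans_le hsol.optimal.1.1
    have hev : ∀ᶠ x in 𝓝 D.x₀, x ∈ D.X → 0 < D.h a x :=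
      eventually_nhdsWithin_iff.1 ((hcont a D.x₀ hx₀).eventually (lt_mem_nhds hpos))
    intro hzero
    refine hsupp _ hev (measure_mono_null_ae ?_ hzero)
    filter_upwards [hPX] with x hx hV
    exact ⟨hx, (hV hx).le⟩
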